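/- Let $R_3=\mathbb Z[q,q^{-1},(q+1)^{-1},\tfrac12]$ with $q$ an indeterminate, let $n\ge 1$, and let $\mathscr H=\mathscr H_{R_3,B_n}(1,q)$ be the Hecke algebra of type $B_n$, i.e. the $R_3$-algebra with generators $a_1,\dots,a_n$ and relations $a_1^2=1$; $a_i^2=(q-1)a_i+q$ for $i\ge2$; $a_1a_2a_1a_2=a_2a_1a_2a_1$; $a_ia_{i+1}a_i=a_{i+1}a_ia_{i+1}$ for $2\le i\le n-1$; and $a_ia_j=a_ja_i$ for $|i-j|>1$. Let $\natural$ and $\flat$ be the involutive algebra automorphisms of $\mathscr H$ with $a_1^\natural=-a_1$, $a_1^\flat=a_1$ and $a_i^\natural=a_i^\flat=(q-1)-a_i$ for $i\ge2$. Put $b_1=\frac{a_1-a_1^\natural}{2}=a_1$ and $b_i=\frac{a_i-a_i^\natural}{q+1}$ for $i\ge2$. For $1\le i\le n$ let $\mathcal S_i$ be the set of the $2i$ initial segments (including the empty one) of the word $b_ib_{i-1}\cdots b_2b_1b_2\cdots b_{i-1}b_i$. A monomial in $b_i$-normal form is a product $U_1U_2\cdots U_n$ with $U_i\in\mathcal S_i$;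 it is called even if its word has an even number of letters $b_i$ with $i\ne1$. Let $\mathscr H^{\flat}=\{h\in\mathscr H: h^\flat=h\}$ and $\mathscr H^{-\flat}=\{h\in\mathscr H: h^\flat=-h\}$. (1) The even monomials in $b_i$-normal form are linearly independent over $R_3$, and their $R_3$-span is $\mathscr H^\flat$; that is, $\mathscr H^\flat=\bigoplus_{M}R_3M$, where $M$ runs over the even monomials in $b_i$-normal form. (2) If $n\ge2$, then $\mathscr H^\flat$ is a free $R_3$-module of rank $2^{n-1}n!$. (3) If $n\ge2$, then $\mathscr H$ is a $\mathbb Z_2$-crossed product with $A_{\bar0}=\mathscr H^\flat$, $A_{\bar1}=\mathscr H^{-\flat}$ and units $c_{\bar0}=1\in A_{\bar0}$, $c_{\bar1}=b_2\in A_{\bar1}$; that is, $\mathscr H$ is a finitely generated $R_3$-module, $A_sA_t=A_{s+t}$ for all $s,t\in\mathbb Z_2$, each $c_s$ is a unit of $\mathscr H$ and $A_s=c_sA_{\bar0}=A_{\bar0}c_s$, $\mathscr H=A_{\bar0}\oplus A_{\bar1}$, and $1\in A_{\bar0}$. -/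

import Mathlib

open Polynomial

/-! ### The Hecke algebra of type `B_n`

The generators `a_1, …, a_n` are indexed by `Fin n`; the index `i : Fin n` stands for the
generator `a_{i+1}`, so that the special generator `a_1` has the index with value `0`. -/

/-- The parameter of the generator with index `i`: `u` for the first one, `q` for the others. -/
def heckeParam {R : Type*} (u q : R) {n : ℕ} (i : Fin n) : R :=
  if i.val = 0 then u else q

/-- The defining relations of the Hecke algebra of type `B_n` with parameters `u, q`. -/
inductive HeckeBRel {R : Type*} [CommRing R] (u q : R) (n : ℕ) :
    FreeAlgebra R (Fin n) → FreeAlgebra R (Fin n) → Prop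
  /-- `a_i ^ 2 = (q_i - 1) a_i + q_i`, with `q_1 = u` and `q_i = q` for `i ≥ 2`. -/
  | quad (i : Fin n) : HeckeBRel u q n
      (FreeAlgebra.ι R i * FreeAlgebra.ι R i)
      ((heckeParam u q i - 1) • FreeAlgebra.ι R i + heckeParam u q i • 1)
  /-- `a_1 a_2 a_1 a_2 = a_2 a_1 a_2 a_1`. -/
  | braid_four (i j : Fin n) (hi : i.val = 0) (hj : j.val = 1) : HeckeBRel u q n
      (FreeAlgebra.ι R i * FreeAlgebra.ι R j * FreeAlgebra.ι R i * FreeAlgebra.ι R j)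
      (FreeAlgebra.ι R j * FreeAlgebra.ι R i * FreeAlgebra.ι R j * FreeAlgebra.ι R i)
  /-- `a_i a_{i+1} a_i = a_{i+1} a_i a_{i+1}` for `i ≥ 2`. -/
  | braid_three (i j : Fin n) (hi : i.val ≠ 0) (hj : j.val = i.val + 1) : HeckeBRel u q n
      (FreeAlgebra.ι R i * FreeAlgebra.ι R j * FreeAlgebra.ι R i)
      (FreeAlgebra.ι R j * FreeAlgebra.ι R i * FreeAlgebra.ι R j)
  /-- `a_i a_j = a_j a_i` for `|i - j| > 1`. -/
  | comm (i j : Fin n) (hij : i.val + 1 < j.val) : HeckeBRel u q n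
      (FreeAlgebra.ι R i * FreeAlgebra.ι R j)
      (FreeAlgebra.ι R j * FreeAlgebra.ι R i)

/-- The Hecke algebra of type `B_n` over `R` with parameters `u, q`. -/
def HeckeB (R : Type*) [CommRing R] (u q : R) (n : ℕ) : Type _ :=
  RingQuot (HeckeBRel u q n)

namespace HeckeB

noncomputable section

variable {R : Type*} [CommRing R] {u q : R} {n : ℕ}

instance : Ring (HeckeB R u q n) := inferInstanceAs (Ring (RingQuot (HeckeBRel u q n)))

instance : Algebra R (HeckeB R u q n) :=
  inferInstanceAs (Algebra R (RingQuot (HeckeBRel u q n)))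

/-- The quotient map from the free algebra. -/
def mk : FreeAlgebra R (Fin n) →ₐ[R] HeckeB R u q n :=
  RingQuot.mkAlgHom R (HeckeBRel u q n)

/-- The generator `a_{i+1}` of the Hecke algebra. -/
def a (i : Fin n) : HeckeB R u q n := mk (FreeAlgebra.ι R i)

theorem mk_rel {x y : FreeAlgebra R (Fin n)} (h : HeckeBRel u q n x y) :
    (mk x : HeckeB R u q n) = mk y :=
  RingQuot.mkAlgHom_rel R h

theorem a_quad (i : Fin n) : (a i * a i : HeckeB R u q n) =
    (heckeParam u q i - 1) • a i + heckeParam u q i • 1 := by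
  simpa only [map_mul, map_add, map_smul, map_one, a] using mk_rel (HeckeBRel.quad (u := u) (q := q) i)

theorem a_quad_of_ne (i : Fin n) (hi : i.val ≠ 0) : (a i * a i : HeckeB R u q n) =
    (q - 1) • a i + q • 1 := by
  have h := a_quad (u := u) (q := q) i
  rwa [heckeParam, if_neg hi] at h

theorem a_braid_four (i j : Fin n) (hi : i.val = 0) (hj : j.val = 1) :
    (a i * a j * a i * a j : HeckeB R u q n) = a j * a i * a j * a i := by
  simpa only [map_mul, a] using mk_rel (HeckeBRel.braid_four (u := u) (q := q) i j hi hj)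

theorem a_braid_three (i j : Fin n) (hi : i.val ≠ 0) (hj : j.val = i.val + 1) :
    (a i * a j * a i : HeckeB R u q n) = a j * a i * a j := by
  simpa only [map_mul, a] using mk_rel (HeckeBRel.braid_three (u := u) (q := q) i j hi hj)

theorem a_comm (i j : Fin n) (hij : i.val + 1 < j.val) :
    (a i * a j : HeckeB R u q n) = a j * a i := by
  simpa only [map_mul, a] using mk_rel (HeckeBRel.comm (u := u) (q := q) i j hij)

/-- The universal property of the presentation. -/
def lift {A : Type*} [Ring A] [Algebra R A] (f : Fin n → A)
    (h : ∀ x y, HeckeBRel u q n x y → FreeAlgebra.lift R f x = FreeAlgebra.lift R f y) :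
    HeckeB R u q n →ₐ[R] A :=
  RingQuot.liftAlgHom R ⟨FreeAlgebra.lift R f, fun {x y} hxy => h x y hxy⟩

theorem lift_a {A : Type*} [Ring A] [Algebra R A] (f : Fin n → A)
    (h : ∀ x y, HeckeBRel u q n x y → FreeAlgebra.lift R f x = FreeAlgebra.lift R f y)
    (i : Fin n) : lift f h (a i : HeckeB R u q n) = f i := by
  have := RingQuot.liftAlgHom_mkAlgHom_apply R (FreeAlgebra.lift R f)
    (s := HeckeBRel u q n) (fun {x y} hxy => h x y hxy) (FreeAlgebra.ι R i)
  rw [FreeAlgebra.lift_ι_apply] at this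
  exact this

theorem algHom_ext {A : Type*} [Ring A] [Algebra R A] {f g : HeckeB R u q n →ₐ[R] A}
    (h : ∀ i, f (a i) = g (a i)) : f = g := by
  apply RingQuot.ringQuot_ext' (S := R)
  apply FreeAlgebra.hom_ext
  funext i
  exact h i

section aux

variable {A : Type*} [Ring A] [Algebra R A]

theorem aux_quad {p : R} {x : A} (hx : x * x = (p - 1) • x + p • 1) :
    ((p - 1) • 1 - x) * ((p - 1) • 1 - x) = (p - 1) • ((p - 1) • 1 - x) + p • (1 : A) := by
  simp only [sub_mul, mul_sub, smul_mul_assoc, mul_smul_comm, one_mul, mul_one, hx]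
  module

theorem aux_four {p r : R} {x y : A} (hx : x * x = (p - 1) • x + p • 1)
    (hy : y * y = (r - 1) • y + r • 1) (h : x * y * x * y = y * x * y * x) :
    ((p - 1) • 1 - x) * ((r - 1) • 1 - y) * ((p - 1) • 1 - x) * ((r - 1) • 1 - y) =
    ((r - 1) • 1 - y) * ((p - 1) • 1 - x) * ((r - 1) • 1 - y) * ((p - 1) • (1 : A) - x) := by
  simp only [mul_assoc] at h
  simp only [sub_mul, mul_sub, smul_mul_assoc, mul_smul_comm, one_mul, mul_one, mul_assoc,
    hx, hy, h, mul_add, add_mul]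
  module

theorem aux_three {p : R} {x y : A} (hx : x * x = (p - 1) • x + p • 1)
    (hy : y * y = (p - 1) • y + p • 1) (h : x * y * x = y * x * y) :
    ((p - 1) • 1 - x) * ((p - 1) • 1 - y) * ((p - 1) • 1 - x) =
    ((p - 1) • 1 - y) * ((p - 1) • 1 - x) * ((p - 1) • (1 : A) - y) := by
  simp only [mul_assoc] at h
  simp only [sub_mul, mul_sub, smul_mul_assoc, mul_smul_comm, one_mul, mul_one, mul_assoc,
    hx, hy, h]
  module

theorem aux_comm {p r : R} {x y : A} (h : x * y = y * x) :
    (p • 1 - x) * (r • 1 - y) = (r • 1 - y) * (p • (1 : A) - x) := by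
  simp only [sub_mul, mul_sub, smul_mul_assoc, mul_smul_comm, one_mul, mul_one, h]
  module

theorem aux_four' {r : R} {x y : A} (hx : x * x = 1) (h : x * y * x * y = y * x * y * x) :
    x * (r • 1 - y) * x * (r • 1 - y) = (r • 1 - y) * x * (r • (1 : A) - y) * x := by
  simp only [mul_assoc] at h
  simp only [sub_mul, mul_sub, smul_mul_assoc, mul_smul_comm, one_mul, mul_one, mul_assoc,
    hx, h]
  module

end aux

/-- The Goldman involution `♮`: the algebra endomorphism with `a_i^♮ = (q_i - 1) - a_i`. -/
def natural : HeckeB R u q n →ₐ[R] HeckeB R u q n :=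
  lift (fun i => (heckeParam u q i - 1) • 1 - a i) (by
    intro x y h
    cases h with
    | quad i =>
      simp only [map_mul, map_add, map_smul, map_one, FreeAlgebra.lift_ι_apply]
      exact aux_quad (a_quad i)
    | braid_four i j hi hj =>
      simp only [map_mul, FreeAlgebra.lift_ι_apply]
      exact aux_four (a_quad i) (a_quad j) (a_braid_four i j hi hj)
    | braid_three i j hi hj =>
      have hp : heckeParam u q j = heckeParam u q i := by
        simp [heckeParam, hi, hj]
      simp only [map_mul, FreeAlgebra.lift_ι_apply, hp]
      exact aux_three (a_quad i) (hp ▸ a_quad j) (a_braid_three i j hi hj)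
    | comm i j hij =>
      simp only [map_mul, FreeAlgebra.lift_ι_apply]
      exact aux_comm (a_comm i j hij))

theorem natural_a (i : Fin n) :
    natural (a i : HeckeB R u q n) = (heckeParam u q i - 1) • 1 - a i :=
  lift_a _ _ i

/-- The endomorphism `♭` in the case `u = 1`, with `a_1^♭ = a_1` and
`a_i^♭ = (q - 1) - a_i` for `i ≥ 2`. -/
def flatHom : HeckeB R 1 q n →ₐ[R] HeckeB R 1 q n :=
  lift (fun i => if i.val = 0 then a i else (q - 1) • 1 - a i) (by
    intro x y h
    cases h with
    | quad i =>
      simp only [map_mul, map_add, map_smul, map_one, FreeAlgebra.lift_ι_apply]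
      split_ifs with hi
      · exact a_quad i
      · rw [heckeParam, if_neg hi]
        exact aux_quad (a_quad_of_ne i hi)
    | braid_four i j hi hj =>
      have hp : heckeParam 1 q i = 1 := by simp [heckeParam, hi]
      have hi2 : (a i * a i : HeckeB R 1 q n) = 1 := by
        rw [a_quad, hp]; simp
      simp only [map_mul, FreeAlgebra.lift_ι_apply, hi, hj, if_true, one_ne_zero, if_false]
      exact aux_four' hi2 (a_braid_four i j hi hj)
    | braid_three i j hi hj =>
      have hj0 : j.val ≠ 0 := by omega
      simp only [map_mul, FreeAlgebra.lift_ι_apply, if_neg hi, if_neg hj0]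
      exact aux_three (a_quad_of_ne i hi) (a_quad_of_ne j hj0) (a_braid_three i j hi hj)
    | comm i j hij =>
      have hj0 : j.val ≠ 0 := by omega
      simp only [map_mul, FreeAlgebra.lift_ι_apply, if_neg hj0]
      split_ifs with hi
      · simp only [mul_sub, sub_mul, mul_smul_comm, smul_mul_assoc, one_mul, mul_one,
          a_comm i j hij]
      · exact aux_comm (a_comm i j hij))

theorem flatHom_a (i : Fin n) : flatHom (a i : HeckeB R 1 q n) =
    if i.val = 0 then a i else (q - 1) • 1 - a i :=
  lift_a _ _ i

theorem flatHom_comp_flatHom :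
    (flatHom (R := R) (q := q) (n := n)).comp flatHom = AlgHom.id R _ := by
  apply algHom_ext
  intro i
  by_cases hi : i.val = 0 <;> simp [flatHom_a, hi]

/-- The involutive automorphism `♭` of the Hecke algebra with `u = 1`. -/
def flat : HeckeB R 1 q n ≃ₐ[R] HeckeB R 1 q n :=
  AlgEquiv.ofAlgHom flatHom flatHom flatHom_comp_flatHom flatHom_comp_flatHom

theorem flat_a (i : Fin n) : flat (a i : HeckeB R 1 q n) =
    if i.val = 0 then a i else (q - 1) • 1 - a i :=
  flatHom_a i

variable (R q n) in
/-- The subalgebra of the elements fixed by `♭`. -/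
def flatFixed : Subalgebra R (HeckeB R 1 q n) where
  carrier := {h | flat h = h}
  mul_mem' {x y} hx hy := by
    simp only [Set.mem_ofPred_eq] at *
    rw [map_mul, hx, hy]
  add_mem' {x y} hx hy := by
    simp only [Set.mem_ofPred_eq] at *
    rw [map_add, hx, hy]
  algebraMap_mem' r := flat.commutes r

variable (R q n) in
/-- The submodule of the elements `h` with `h^♭ = -h`. -/
def flatAnti : Submodule R (HeckeB R 1 q n) where
  carrier := {h | flat h = -h}
  zero_mem' := by simp
  add_mem' {x y} hx hy := by
    simp only [Set.mem_ofPred_eq] at *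
    rw [map_add, hx, hy, neg_add]
  smul_mem' r x hx := by
    simp only [Set.mem_ofPred_eq] at *
    rw [map_smul, hx, smul_neg]

/-- The elements `b_i = (a_i - a_i^♮) / (q_i + 1)`, with `q_1 = u` and `q_i = q` for `i ≥ 2`
(to be used only where `u + 1` and `q + 1` are units). -/
def b (i : Fin n) : HeckeB R u q n :=
  Ring.inverse (heckeParam u q i + 1) • (a i - natural (a i))

end

end HeckeB

/-! ### Words in normal form -/

/-- The longest word `b_i b_{i-1} ⋯ b_2 b_1 b_2 ⋯ b_{i-1} b_i`, as the list of its indices.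
The other words of the set `S_i` are its initial segments. -/
def longWord {n : ℕ} (i : Fin n) : List (Fin n) :=
  ((List.finRange n).filter (fun j => j ≤ i)).reverse ++
    (List.finRange n).filter (fun j => 0 < j.val ∧ j ≤ i)

/-- The choice of one element `U_i` of each `S_i`, `i = 1, …, n`; the element of `S_i` is given
by its length, one of `0, …, 2 i - 1` (with `i` counted from `1`). -/
abbrev NormalIndex (n : ℕ) : Type :=
  (i : Fin n) → Fin (2 * (i.val + 1))

/-- The word `U_1 U_2 ⋯ U_n` in normal form. -/
def normalWord {n : ℕ} (k : NormalIndex n) : List (Fin n) :=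
  (List.finRange n).flatMap (fun i => (longWord i).take (k i).val)

/-- The word `U_1 U_2 ⋯ U_n` has an even number of letters `b_i` with `i ≠ 1`. -/
def IsFlatEven {n : ℕ} (k : NormalIndex n) : Prop :=
  Even ((normalWord k).countP (fun j => j.val ≠ 0))

/-- The monomial `U_1 U_2 ⋯ U_n` in `b_i`-normal form. -/
noncomputable def normalMonomial {R : Type*} [CommRing R] (u q : R) {n : ℕ}
    (k : NormalIndex n) : HeckeB R u q n :=
  ((normalWord k).map HeckeB.b).prod

/-! ### Graded Clifford systems -/

/-- The family `A` of submodules of the `R`-algebra `H`, indexed by the group `S`, is an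
`S`-graded Clifford system in `H` with the units `c s ∈ A s`; so `H` is an `S`-crossed product. -/
structure IsGradedCliffordSystem {S R H : Type*} [Group S] [Finite S] [DecidableEq S]
    [CommRing R] [Ring H] [Algebra R H] (A : S → Submodule R H) (c : S → H) : Prop where
  finite : Module.Finite R H
  mul_eq : ∀ s t, A s * A t = A (s * t)
  isUnit : ∀ s, IsUnit (c s)
  mem : ∀ s, c s ∈ A s
  left_eq : ∀ s, A s = (A 1).map (LinearMap.mulLeft R (c s))
  right_eq : ∀ s, A s = (A 1).map (LinearMap.mulRight R (c s))
  isInternal : DirectSum.IsInternal A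
  one_mem : (1 : H) ∈ A 1

/-! ### The coefficient ring -/

/-- The ring `ℤ[q, q⁻¹, (q + 1)⁻¹, 1/2]`, with `q` an indeterminate. -/
abbrev R3 : Type := Localization.Away (2 * X * (X + 1) : ℤ[X])

/-- The indeterminate `q` of `R3`. -/
noncomputable def R3.q : R3 := algebraMap ℤ[X] R3 X

theorem R3.isUnit_aux : IsUnit (2 * R3.q * (R3.q + 1)) := by
  have h := IsLocalization.Away.algebraMap_isUnit (S := R3) (2 * X * (X + 1) : ℤ[X])
  simpa only [map_mul, map_add, map_one, map_ofNat, R3.q] using h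

theorem R3.isUnit_two : IsUnit (2 : R3) :=
  isUnit_of_mul_isUnit_left (isUnit_of_mul_isUnit_left R3.isUnit_aux)

theorem R3.isUnit_q : IsUnit R3.q :=
  isUnit_of_mul_isUnit_right (isUnit_of_mul_isUnit_left R3.isUnit_aux)

theorem R3.isUnit_q_add_one : IsUnit (R3.q + 1) :=
  isUnit_of_mul_isUnit_right R3.isUnit_aux

/-! The elements `b_i` are eigenvectors of `♭`: `b_1` is fixed and `b_i` is negated for `i ≥ 2`. A
monomial in the `b_i` is therefore fixed or negated according to the parity of its number of letters
other than `b_1`. Once the monomials in `b_i`-normal form are known to be a basis, inverting 2 makes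
the even ones a basis of the fixed algebra. For `n ≥ 2` the involution `b_2`, which is negated by
`♭`, exchanges the two eigenspaces by multiplication; this gives the rank and the crossed product.

The substance is thus the basis theorem, proved first for the generators `a_i`. The initial segments
`d_t` of `a_k ⋯ a_1 a_0 a_1 ⋯ a_k` (letters counted from 0) represent the `2k + 2` cosets of the
group `B_k` in `B_{k+1}`. A generator moves past `d_t` to become a generator of the smaller algebra,
or it lengthens or shortens `d_t` (`cosetWord_prod_mul`). Hence the normal monomials span, and right
multiplication by a generator raises length by at most one (`mul_mem_normalSpan`). Independence
comes from an explicit model of the induced module: the same rules define operators on the free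
module with basis the `d_t` over the smaller algebra (`cosetOp`). These satisfy the Hecke relations,
and a monomial `m d_t` sends the first basis vector to `m` in position `t`, so induction on the rank
applies (`linearIndependent_natGen`).

Finally `b_i` is a unit multiple of `a_i` plus a scalar. Passing from `a` to `b` is therefore
triangular for length with unit diagonal (`span_affine`), and a spanning family of cardinality equal
to the rank is independent. -/

/-! ### Families of elements satisfying the Hecke relations -/

/-- Letter number `s` of the word `k, k - 1, …, 1, 0, 1, …, k`. -/
def cosetLetter (k s : ℕ) : ℕ := (k - s) + (s - k)

/-- The initial segment of length `t` of the word `k, k - 1, …, 1, 0, 1, …, k`. -/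
def cosetWord (k t : ℕ) : List ℕ := (List.range t).map (cosetLetter k)

/-- The point of `{0, …, k}` to which the signed permutation given by the word `cosetWord k t`
moves `k`, up to sign. -/
def cosetPoint (k t : ℕ) : ℕ := (k - t) + (t - (k + 1))

theorem cosetWord_zero (k : ℕ) : cosetWord k 0 = [] := rfl

theorem cosetWord_succ (k t : ℕ) : cosetWord k (t + 1) = cosetWord k t ++ [cosetLetter k t] := by
  simp [cosetWord, List.range_succ]

theorem length_cosetWord (k t : ℕ) : (cosetWord k t).length = t := by simp [cosetWord]

/-- The word in normal form with the parts `cosetWord i (K i)` for `i < n`. -/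
def natNormalWord (n : ℕ) (K : ℕ → ℕ) : List ℕ :=
  (List.range n).flatMap fun i => cosetWord i (K i)

theorem natNormalWord_succ (n : ℕ) (K : ℕ → ℕ) :
    natNormalWord (n + 1) K = natNormalWord n K ++ cosetWord n (K n) := by
  simp [natNormalWord, List.range_succ]

theorem natNormalWord_congr {n : ℕ} {K L : ℕ → ℕ} (h : ∀ i < n, K i = L i) :
    natNormalWord n K = natNormalWord n L := by
  induction n with
  | zero => rfl
  | succ n ih =>
    rw [natNormalWord_succ, natNormalWord_succ, ih fun i hi => h i (by omega), h n (by omega)]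

theorem lt_of_mem_cosetWord {k t j : ℕ} (ht : t ≤ 2 * k + 1) (hj : j ∈ cosetWord k t) :
    j < k + 1 := by
  simp only [cosetWord, List.mem_map, List.mem_range, cosetLetter] at hj
  omega

theorem lt_of_mem_natNormalWord {n j : ℕ} {K : ℕ → ℕ} (hK : ∀ i < n, K i ≤ 2 * i + 1)
    (hj : j ∈ natNormalWord n K) : j < n := by
  simp only [natNormalWord, List.mem_flatMap, List.mem_range] at hj
  obtain ⟨i, hi, hj⟩ := hj
  have := lt_of_mem_cosetWord (hK i hi) hj
  omega

/-- The parameter of the generator with index `i`. -/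
def natParam {R : Type*} (u q : R) (i : ℕ) : R := if i = 0 then u else q

theorem natParam_of_ne {R : Type*} (u q : R) {i : ℕ} (hi : i ≠ 0) : natParam u q i = q :=
  if_neg hi

/-- The elements `a 0, …, a (n - 1)` satisfy the relations of the Hecke algebra of type `B_n`. -/
structure IsHeckeFamily {R A : Type*} [CommRing R] [Ring A] [Algebra R A] (u q : R) (n : ℕ)
    (a : ℕ → A) : Prop where
  quad : ∀ i < n, a i * a i = (natParam u q i - 1) • a i + natParam u q i • (1 : A)
  four : 1 < n → a 0 * a 1 * a 0 * a 1 = a 1 * a 0 * a 1 * a 0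
  three : ∀ i, i ≠ 0 → i + 1 < n → a i * a (i + 1) * a i = a (i + 1) * a i * a (i + 1)
  comm : ∀ i j, i + 1 < j → j < n → a i * a j = a j * a i

namespace IsHeckeFamily

variable {R A : Type*} [CommRing R] [Ring A] [Algebra R A] {u q : R} {n : ℕ} {a : ℕ → A}

/-- Write `p` for `cosetPoint k t`. Only the reflections `p` and `p + 1` move the point `p`; all
others lie in its stabilizer. Conjugation by the coset word carries that stabilizer to the group on
the coordinates below `k`, and since `p` is deleted, the indices above it drop by one. -/
theorem cosetWord_prod_mul (ha : IsHeckeFamily u q n a) {k : ℕ} (hk : k < n) (t : ℕ)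
    (ht : t ≤ 2 * k + 1) :
    (∀ j, j < cosetPoint k t → j ≤ k →
      ((cosetWord k t).map a).prod * a j = a j * ((cosetWord k t).map a).prod) ∧
    (∀ j, cosetPoint k t + 1 < j → j ≤ k →
      ((cosetWord k t).map a).prod * a j = a (j - 1) * ((cosetWord k t).map a).prod) := by
  have hcomm : ∀ i j, i < n → j < n → (i + 1 < j ∨ j + 1 < i) → a i * a j = a j * a i := by
    rintro i j hi hj (h | h)
    · exact ha.comm i j h hj
    · exact (ha.comm j i h hi).symm
  have hstep : ∀ t, ((cosetWord k (t + 1)).map a).prod =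
      ((cosetWord k t).map a).prod * a (cosetLetter k t) := by
    intro t; simp [cosetWord_succ]
  induction t using Nat.strong_induction_on with
  | _ t ih =>
  obtain _ | t := t
  · simp only [cosetPoint, cosetWord_zero]
    refine ⟨fun j _ _ => by simp, fun j h1 h2 => by omega⟩
  -- a letter that commutes with the last one
  have far : ∀ j j', j ≤ k → (j + 1 < cosetLetter k t ∨ cosetLetter k t + 1 < j) →
      ((cosetWord k t).map a).prod * a j = a j' * ((cosetWord k t).map a).prod →
      ((cosetWord k (t + 1)).map a).prod * a j = a j' * ((cosetWord k (t + 1)).map a).prod := by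
    intro j j' hj hfar h
    rw [hstep, mul_assoc, hcomm _ j (by simp only [cosetLetter]; omega) (by omega) (by omega),
      ← mul_assoc, h, mul_assoc]
  have ih0 := ih t (by omega) (by omega)
  rcases Nat.lt_or_ge t k with htk | htk
  · constructor
    · intro j h1 h2
      simp only [cosetPoint, cosetLetter] at *
      exact far j j h2 (by omega) (ih0.1 j (by omega) h2)
    · intro j h1 h2
      by_cases hj : j = k - t + 1
      · obtain _ | t := t
        · omega
        have ih1 := (ih t (by omega) (by omega)).1 (k - (t + 1))
          (by simp only [cosetPoint]; omega) (by omega)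
        have e1 : cosetLetter k t = k - (t + 1) + 1 := by simp only [cosetLetter]; omega
        have e2 : cosetLetter k (t + 1) = k - (t + 1) := by simp only [cosetLetter]; omega
        have hb := ha.three (k - (t + 1)) (by omega) (by omega)
        rw [hstep, hstep, e1, e2, hj]
        rw [show k - (t + 1) + 1 - 1 = k - (t + 1) by omega]
        rw [mul_assoc _ (a (k - (t + 1) + 1)), mul_assoc, ← hb, ← mul_assoc, ← mul_assoc, ih1]
        simp only [mul_assoc]
      · simp only [cosetPoint, cosetLetter] at *
        exact far j (j - 1) h2 (by omega) (ih0.2 j (by omega) h2)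
  · rcases Nat.eq_or_lt_of_le htk with rfl | htk
    · constructor
      · intro j h1 h2
        simp only [cosetPoint] at h1
        omega
      · intro j h1 h2
        simp only [cosetPoint, cosetLetter] at *
        exact far j (j - 1) h2 (by omega) (ih0.2 j (by omega) h2)
    · constructor
      · intro j h1 h2
        by_cases hj : j + 1 = t - k
        · obtain _ | t := t
          · omega
          have e1 : cosetLetter k t = j := by simp only [cosetLetter]; omega
          have e2 : cosetLetter k (t + 1) = j + 1 := by simp only [cosetLetter]; omega
          -- The word ends in `j, j + 1`. For `j = 0` its last three letters are `1, 0, 1`, and the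
          -- braid relation of length four is needed.
          by_cases hj0 : j = 0
          · subst hj0
            obtain _ | t := t
            · omega
            have e0 : cosetLetter k t = 1 := by simp only [cosetLetter]; omega
            have ih1 := (ih t (by omega) (by omega)).1 0
              (by simp only [cosetPoint]; omega) (by omega)
            have hb := ha.four (by omega)
            rw [hstep, hstep, hstep, e0, e1, e2, zero_add]
            calc _ = ((cosetWord k t).map a).prod * (a 1 * a 0 * a 1 * a 0) := by
                    simp only [mul_assoc]
              _ = _ := by rw [← hb]; simp only [← mul_assoc]; rw [ih1]
          · have ih1 := (ih t (by omega) (by omega)).2 (j + 1)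
              (by simp only [cosetPoint]; omega) (by omega)
            have hb := ha.three j hj0 (by omega)
            rw [hstep, hstep, e1, e2]
            rw [mul_assoc _ (a j), mul_assoc, hb, ← mul_assoc, ← mul_assoc, ih1]
            simp only [mul_assoc, Nat.add_sub_cancel]
        · simp only [cosetPoint, cosetLetter] at *
          exact far j j h2 (by omega) (ih0.1 j (by omega) h2)
      · intro j h1 h2
        simp only [cosetPoint, cosetLetter] at *
        exact far j (j - 1) h2 (by omega) (ih0.2 j (by omega) h2)

end IsHeckeFamily

/-! ### The length filtration -/

section Filtration

variable {A : Type*} [Ring A]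

variable (R : Type*) [CommRing R] [Algebra R A]

/-- The span of the monomials of length at most `l` in normal form in the first `n` letters. -/
def normalSpan (a : ℕ → A) (n l : ℕ) : Submodule R A :=
  Submodule.span R {x | ∃ K : ℕ → ℕ, (∀ i < n, K i ≤ 2 * i + 1) ∧
    (natNormalWord n K).length ≤ l ∧ x = ((natNormalWord n K).map a).prod}

variable {R}

theorem normalSpan_mono (a : ℕ → A) (n : ℕ) {l m : ℕ} (h : l ≤ m) :
    normalSpan R a n l ≤ normalSpan R a n m := by
  apply Submodule.span_mono
  rintro x ⟨K, h1, h2, h3⟩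
  exact ⟨K, h1, h2.trans h, h3⟩

theorem one_mem_normalSpan (a : ℕ → A) (n l : ℕ) : (1 : A) ∈ normalSpan R a n l := by
  have h : natNormalWord n (fun _ => 0) = [] := by
    simp [natNormalWord, cosetWord]
  refine Submodule.subset_span ⟨fun _ => 0, fun i _ => Nat.zero_le _, ?_, ?_⟩ <;> simp [h]

theorem mul_cosetWord_mem_normalSpan (a : ℕ → A) {n l t : ℕ} (ht : t ≤ 2 * n + 1) {x : A}
    (hx : x ∈ normalSpan R a n l) :
    x * ((cosetWord n t).map a).prod ∈ normalSpan R a (n + 1) (l + t) := by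
  induction hx using Submodule.span_induction with
  | mem x hx =>
    obtain ⟨K, h1, h2, rfl⟩ := hx
    have h : natNormalWord (n + 1) (Function.update K n t) =
        natNormalWord n K ++ cosetWord n t := by
      rw [natNormalWord_succ, Function.update_self, natNormalWord_congr (L := K)]
      intro i hi
      rw [Function.update_of_ne (by omega)]
    refine Submodule.subset_span ⟨Function.update K n t, fun i hi => ?_, ?_, ?_⟩
    · by_cases hin : i = n
      · subst hin; simpa using ht
      · rw [Function.update_of_ne hin]; exact h1 i (by omega)
    · rw [h, List.length_append, length_cosetWord]; omega
    · rw [h, List.map_append, List.prod_append]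
  | zero => rw [zero_mul]; exact zero_mem _
  | add x y _ _ hx hy => rw [add_mul]; exact add_mem hx hy
  | smul r x _ hx => rw [smul_mul_assoc]; exact Submodule.smul_mem _ _ hx

/-- In a monomial `m d_t` the new letter either passes `d_t` and is absorbed by `m` through
induction, or changes `t` by one. The bound on the length is what later makes the change from `a_i`
to `b_i` triangular. -/
theorem IsHeckeFamily.mul_mem_normalSpan {u q : R} {n : ℕ} {a : ℕ → A}
    (ha : IsHeckeFamily u q n a) {k : ℕ} (hk : k ≤ n) {j : ℕ} (hj : j < k) {l : ℕ} {x : A}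
    (hx : x ∈ normalSpan R a k l) : x * a j ∈ normalSpan R a k (l + 1) := by
  induction k generalizing j l x with
  | zero => omega
  | succ k ih =>
  induction hx using Submodule.span_induction with
  | zero => rw [zero_mul]; exact zero_mem _
  | add x y _ _ hx hy => rw [add_mul]; exact add_mem hx hy
  | smul r x _ hx => rw [smul_mul_assoc]; exact Submodule.smul_mem _ _ hx
  | mem x hx =>
    obtain ⟨K, h1, h2, rfl⟩ := hx
    rw [natNormalWord_succ, List.length_append, length_cosetWord] at h2
    rw [natNormalWord_succ, List.map_append, List.prod_append, mul_assoc]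
    obtain ⟨t, ht⟩ : ∃ t, t = K k := ⟨_, rfl⟩
    have ht' := h1 k (by omega)
    rw [← ht] at ht' h2 ⊢
    have hm : ((natNormalWord k K).map a).prod ∈
        normalSpan R a k (natNormalWord k K).length :=
      Submodule.subset_span ⟨K, fun i hi => h1 i (by omega), le_rfl, rfl⟩
    obtain ⟨hlt, hgt⟩ := ha.cosetWord_prod_mul (by omega : k < n) t ht'
    rcases Nat.lt_or_ge j (cosetPoint k t) with h | h
    · rw [hlt j h (by omega), ← mul_assoc]
      refine normalSpan_mono a _ ?_ (mul_cosetWord_mem_normalSpan a ht'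
        (ih (by omega) (by simp only [cosetPoint] at h; omega) hm))
      omega
    rcases Nat.lt_or_ge (cosetPoint k t + 1) j with h' | h'
    · rw [hgt j h' (by omega), ← mul_assoc]
      refine normalSpan_mono a _ ?_ (mul_cosetWord_mem_normalSpan a ht'
        (ih (by omega) (by omega) hm))
      omega
    -- Only `j = cosetPoint k t` and `j = cosetPoint k t + 1` remain: one of them is the next letter
    -- of the long word, the other the last letter of the present one.
    by_cases hup : j = cosetLetter k t
    · have : ((cosetWord k t).map a).prod * a j = ((cosetWord k (t + 1)).map a).prod := by
        simp [cosetWord_succ, hup]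
      rw [this]
      refine normalSpan_mono a _ ?_ (mul_cosetWord_mem_normalSpan a ?_ hm)
      · omega
      · simp only [cosetPoint, cosetLetter] at *; omega
    obtain _ | t := t
    · simp only [cosetPoint, cosetLetter] at *; omega
    have hdown : j = cosetLetter k t := by
      simp only [cosetPoint, cosetLetter] at *; omega
    have : ((cosetWord k (t + 1)).map a).prod * a j =
        (natParam u q j - 1) • ((cosetWord k (t + 1)).map a).prod +
          natParam u q j • ((cosetWord k t).map a).prod := by
      rw [cosetWord_succ, List.map_append, List.prod_append, List.map_singleton,
        List.prod_singleton, ← hdown, mul_assoc, ha.quad j (by omega), mul_add,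
        mul_smul_comm, mul_smul_comm, mul_one]
    rw [this, mul_add, mul_smul_comm, mul_smul_comm]
    refine add_mem (Submodule.smul_mem _ _ ?_) (Submodule.smul_mem _ _ ?_)
    · exact normalSpan_mono a _ (by omega) (mul_cosetWord_mem_normalSpan a ht' hm)
    · exact normalSpan_mono a _ (by omega)
        (mul_cosetWord_mem_normalSpan a (by omega : t ≤ 2 * k + 1) hm)

theorem IsHeckeFamily.prod_mem_normalSpan {u q : R} {n : ℕ} {a : ℕ → A}
    (ha : IsHeckeFamily u q n a) (w : List ℕ) (hw : ∀ j ∈ w, j < n) :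
    (w.map a).prod ∈ normalSpan R a n w.length := by
  induction w using List.reverseRecOn with
  | nil => simpa using one_mem_normalSpan a n 0
  | append_singleton w j ih =>
    rw [List.map_append, List.prod_append, List.map_singleton, List.prod_singleton,
      List.length_append, List.length_singleton]
    exact ha.mul_mem_normalSpan le_rfl (hw j (by simp))
      (ih fun i hi => hw i (by simp [hi]))

end Filtration

/-! ### The representation on functions on the cosets of `B_n` in `B_{n+1}` -/

section CosetRepresentation

variable {R B : Type*} [CommRing R] [Ring B] [Algebra R B]

/-- The right action of the generator `a_j` of the Hecke algebra of type `B_{n+1}` on the free left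
module with the basis of the coset words `cosetWord n t`, `t ≤ 2 n + 1`, over the Hecke algebra of
type `B_n`, in coordinates. The superfluous coordinates carry the sign representation. -/
def cosetOp (u q : R) (n : ℕ) (b : ℕ → B) (j : ℕ) : Module.End R (ℕ → B) where
  toFun f t :=
    -- The scalar `-1` is a root of every quadratic relation and satisfies the braid relations, so
    -- it is a harmless filler.
    if 2 * n + 2 ≤ t then -f t
    -- This and the next line read off coefficients from `d_t a_j = d_{t+1}` and `d_{t+1} a_j = (p -
    -- 1) d_{t+1} + p d_t`, with `p` the parameter of `j`.
    else if j = cosetLetter n t then natParam u q j • f (t + 1)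
    else if t ≠ 0 ∧ j = cosetLetter n (t - 1) then (natParam u q j - 1) • f t + f (t - 1)
    else if j < cosetPoint n t then f t * b j
    else f t * b (j - 1)
  map_add' f g := by
    ext t
    simp only [Pi.add_apply]
    split_ifs
    · abel
    · rw [smul_add]
    · rw [smul_add]; abel
    · rw [add_mul]
    · rw [add_mul]
  map_smul' r f := by
    ext t
    simp only [Pi.smul_apply, RingHom.id_apply]
    split_ifs
    · rw [smul_neg]
    · rw [smul_comm]
    · rw [smul_add, smul_comm]
    · rw [smul_mul_assoc]
    · rw [smul_mul_assoc]

variable (u q : R) {n : ℕ} (b : ℕ → B) {j : ℕ}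

theorem cosetOp_large (f : ℕ → B) {t : ℕ} (ht : 2 * n + 2 ≤ t) :
    cosetOp u q n b j f t = -f t := if_pos ht

theorem cosetOp_up (f : ℕ → B) {t : ℕ} (ht : t < 2 * n + 2)
    (h : j = cosetLetter n t) :
    cosetOp u q n b j f t = natParam u q j • f (t + 1) := by
  simp only [cosetOp, LinearMap.coe_mk, AddHom.coe_mk]
  rw [if_neg (by omega), if_pos h]

theorem cosetOp_down (f : ℕ → B) {t : ℕ} (ht : t + 1 < 2 * n + 2)
    (h : j = cosetLetter n t) :
    cosetOp u q n b j f (t + 1) = (natParam u q j - 1) • f (t + 1) + f t := by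
  simp only [cosetOp, LinearMap.coe_mk, AddHom.coe_mk]
  rw [if_neg (by omega), if_neg (by simp only [cosetLetter] at *; omega), if_pos ⟨by omega, h⟩]
  rfl

theorem cosetOp_lt (f : ℕ → B) {t : ℕ} (ht : t < 2 * n + 2) (h : j < cosetPoint n t) :
    cosetOp u q n b j f t = f t * b j := by
  simp only [cosetOp, LinearMap.coe_mk, AddHom.coe_mk]
  rw [if_neg (by omega), if_neg (by simp only [cosetLetter, cosetPoint] at *; omega),
    if_neg (by simp only [cosetLetter, cosetPoint] at *; omega), if_pos h]

theorem cosetOp_gt (f : ℕ → B) {t : ℕ} (ht : t < 2 * n + 2) (h : cosetPoint n t + 1 < j) :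
    cosetOp u q n b j f t = f t * b (j - 1) := by
  simp only [cosetOp, LinearMap.coe_mk, AddHom.coe_mk]
  rw [if_neg (by omega), if_neg (by simp only [cosetLetter, cosetPoint] at *; omega),
    if_neg (by simp only [cosetLetter, cosetPoint] at *; omega), if_neg (by omega)]

/-- A position is either superfluous, fixed by the `j`-th generator, or one of two that are
exchanged by it. -/
theorem cosetOp_cases (n : ℕ) {j : ℕ} (hj : j ≤ n) (t : ℕ) :
    2 * n + 2 ≤ t ∨ (t < 2 * n + 2 ∧ j < cosetPoint n t) ∨
      (t < 2 * n + 2 ∧ cosetPoint n t + 1 < j) ∨ (t < 2 * n + 1 ∧ j = cosetLetter n t) ∨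
      ∃ s, t = s + 1 ∧ s < 2 * n + 1 ∧ j = cosetLetter n s := by
  by_cases h : t ≠ 0 ∧ t < 2 * n + 2 ∧ j = cosetLetter n (t - 1)
  · obtain ⟨s, rfl⟩ := Nat.exists_eq_succ_of_ne_zero h.1
    exact Or.inr (Or.inr (Or.inr (Or.inr ⟨s, rfl, by omega, h.2.2⟩)))
  · simp only [cosetLetter, cosetPoint] at *
    omega

variable {u q b}

theorem cosetOp_quad (hb : IsHeckeFamily u q n b) (hj : j ≤ n) (f : ℕ → B) :
    cosetOp u q n b j (cosetOp u q n b j f) =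
      (natParam u q j - 1) • cosetOp u q n b j f + natParam u q j • f := by
  ext t
  simp only [Pi.add_apply, Pi.smul_apply]
  rcases cosetOp_cases n hj t with h | h | h | h | ⟨s, rfl, h⟩
  · simp only [cosetOp_large u q b _ h]
    module
  · simp only [cosetOp_lt u q b _ h.1 h.2]
    rw [mul_assoc, hb.quad j (by simp only [cosetPoint] at h; omega), mul_add, mul_smul_comm,
      mul_smul_comm, mul_one]
  · simp only [cosetOp_gt u q b _ h.1 h.2]
    rw [mul_assoc, hb.quad (j - 1) (by omega), mul_add, mul_smul_comm,
      mul_smul_comm, mul_one, natParam_of_ne u q (by omega : j - 1 ≠ 0),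
      natParam_of_ne u q (by omega : j ≠ 0)]
  · rw [cosetOp_up u q b _ (by omega) h.2, cosetOp_up u q b _ (by omega) h.2,
      cosetOp_down u q b _ (by omega) h.2]
    module
  · rw [cosetOp_down u q b _ (by omega) h.2, cosetOp_up u q b _ (by omega) h.2,
      cosetOp_down u q b _ (by omega) h.2]

theorem cosetOp_comm (hb : IsHeckeFamily u q n b) {i : ℕ} (hij : i + 1 < j) (hj : j ≤ n)
    (f : ℕ → B) :
    cosetOp u q n b i (cosetOp u q n b j f) = cosetOp u q n b j (cosetOp u q n b i f) := by
  ext t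
  have hi : i ≤ n := by omega
  rcases cosetOp_cases n hi t with h | h | h | h | ⟨s, rfl, h⟩
  · simp only [cosetOp_large u q b _ h]
  · simp only [cosetOp_lt u q b _ h.1 h.2]
    rcases cosetOp_cases n hj t with h' | h' | h' | h' | ⟨s, rfl, h'⟩
    · omega
    · simp only [cosetOp_lt u q b _ h'.1 h'.2]
      simp only [cosetOp_lt u q b _ h.1 h.2]
      rw [mul_assoc, mul_assoc, hb.comm i j hij (by simp only [cosetPoint] at h'; omega)]
    · simp only [cosetOp_gt u q b _ h'.1 h'.2]
      simp only [cosetOp_lt u q b _ h.1 h.2]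
      rw [mul_assoc, mul_assoc, hb.comm i (j - 1) (by omega) (by omega)]
    · simp only [cosetOp_up u q b _ h.1 h'.2]
      rw [cosetOp_lt u q b _ (by omega) (by simp only [cosetPoint, cosetLetter] at *; omega),
        smul_mul_assoc]
    · simp only [cosetOp_down u q b _ h.1 h'.2]
      rw [cosetOp_lt u q b _ h.1 h.2,
        cosetOp_lt u q b _ (by omega) (by simp only [cosetPoint, cosetLetter] at *; omega),
        add_mul, smul_mul_assoc]
  · simp only [cosetOp_gt u q b _ h.1 h.2]
    have hg : ∀ g, cosetOp u q n b j g t = g t * b (j - 1) := fun g =>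
      cosetOp_gt u q b _ h.1 (by omega)
    simp only [hg]
    simp only [cosetOp_gt u q b _ h.1 h.2]
    rw [mul_assoc, mul_assoc, hb.comm (i - 1) (j - 1) (by omega) (by omega)]
  · have hg : ∀ g s, s = t ∨ s = t + 1 → cosetOp u q n b j g s = g s * b (j - 1) := by
      intro g s hs
      refine cosetOp_gt u q b _ (by omega) ?_
      simp only [cosetPoint, cosetLetter] at *; omega
    rw [cosetOp_up u q b _ (by omega) h.2, hg _ _ (Or.inl rfl), hg _ _ (Or.inr rfl),
      cosetOp_up u q b _ (by omega) h.2, smul_mul_assoc]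
  · have hg : ∀ g t, t = s ∨ t = s + 1 → cosetOp u q n b j g t = g t * b (j - 1) := by
      intro g t hs
      refine cosetOp_gt u q b _ (by omega) ?_
      simp only [cosetPoint, cosetLetter] at *; omega
    rw [cosetOp_down u q b _ (by omega) h.2, hg _ _ (Or.inl rfl), hg _ _ (Or.inr rfl),
      hg _ _ (Or.inr rfl), cosetOp_down u q b _ (by omega) h.2, add_mul, smul_mul_assoc]

section Abstract

variable {S T : (ℕ → B) → ℕ → B} {h : B}

/-- Local form of the braid relation: `T` exchanges `x, y` and `S` exchanges `y, z`, while at the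
free ends `S` and `T` both multiply by the same element `h`. The relation then needs only the
quadratic relation of `h`. -/
theorem braid_three_of_chain {p : R} (hh : h * h = (p - 1) • h + p • (1 : B)) {x y z : ℕ}
    (Sx : ∀ f, S f x = f x * h) (Sy : ∀ f, S f y = p • f z)
    (Sz : ∀ f, S f z = (p - 1) • f z + f y) (Tx : ∀ f, T f x = p • f y)
    (Ty : ∀ f, T f y = (p - 1) • f y + f x) (Tz : ∀ f, T f z = f z * h) (f : ℕ → B) {t : ℕ}
    (ht : t = x ∨ t = y ∨ t = z) : S (T (S f)) t = T (S (T f)) t := by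
  rcases ht with rfl | rfl | rfl
  · simp only [Sx, Sy, Tx, Tz, smul_mul_assoc]
  all_goals
    simp only [Sx, Sy, Sz, Tx, Ty, Tz, add_mul, smul_mul_assoc, mul_assoc, hh, mul_add,
      mul_smul_comm, mul_one]
    module

/-- The analogue for a chain of four positions, where `T` exchanges `x, y` and `z, w`, and `S`
exchanges `y, z` and multiplies by `h` at both ends. -/
theorem braid_four_of_chain {p r : R} (hh : h * h = (p - 1) • h + p • (1 : B)) {x y z w : ℕ}
    (Sx : ∀ f, S f x = f x * h) (Sy : ∀ f, S f y = p • f z)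
    (Sz : ∀ f, S f z = (p - 1) • f z + f y) (Sw : ∀ f, S f w = f w * h)
    (Tx : ∀ f, T f x = r • f y) (Ty : ∀ f, T f y = (r - 1) • f y + f x)
    (Tz : ∀ f, T f z = r • f w) (Tw : ∀ f, T f w = (r - 1) • f w + f z) (f : ℕ → B) {t : ℕ}
    (ht : t = x ∨ t = y ∨ t = z ∨ t = w) :
    S (T (S (T f))) t = T (S (T (S f))) t := by
  rcases ht with rfl | rfl | rfl | rfl
  · simp only [Sx, Sy, Sw, Tx, Tz, smul_mul_assoc]
  all_goals
    simp only [Sx, Sy, Sz, Sw, Tx, Ty, Tz, Tw, add_mul, smul_mul_assoc, mul_assoc, hh, mul_add,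
      mul_smul_comm, mul_one]
    module

end Abstract

theorem cosetOp_four (hb : IsHeckeFamily u q n b) (hn : 1 ≤ n) (f : ℕ → B) :
    cosetOp u q n b 0 (cosetOp u q n b 1 (cosetOp u q n b 0 (cosetOp u q n b 1 f))) =
    cosetOp u q n b 1 (cosetOp u q n b 0 (cosetOp u q n b 1 (cosetOp u q n b 0 f))) := by
  ext t
  by_cases h : 2 * n + 2 ≤ t
  · simp only [cosetOp_large u q b _ h]
  by_cases h1 : 1 < cosetPoint n t
  · simp only [cosetOp_lt u q b _ (by omega : t < 2 * n + 2) h1,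
      cosetOp_lt u q b _ (by omega : t < 2 * n + 2) (by omega : 0 < cosetPoint n t)]
    have := hb.four (by simp only [cosetPoint] at h1; omega)
    simp only [mul_assoc] at this ⊢
    rw [this]
  obtain ⟨m, rfl⟩ := Nat.exists_eq_add_of_le' hn
  -- With `n = m + 1`, these are the four positions in the middle of the long word, with points `1,
  -- 0, 0, 1`.
  refine braid_four_of_chain (x := m) (y := m + 1) (z := m + 2) (w := m + 3)
    (hb.quad 0 (by omega))
    (fun f => cosetOp_lt u q b f (by omega) (by simp only [cosetPoint]; omega))
    (fun f => cosetOp_up u q b f (by omega) (by simp only [cosetLetter]; omega))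
    (fun f => cosetOp_down u q b f (by omega) (by simp only [cosetLetter]; omega))
    (fun f => cosetOp_lt u q b f (by omega) (by simp only [cosetPoint]; omega))
    (fun f => cosetOp_up u q b f (by omega) (by simp only [cosetLetter]; omega))
    (fun f => cosetOp_down u q b f (by omega) (by simp only [cosetLetter]; omega))
    (fun f => cosetOp_up u q b f (by omega) (by simp only [cosetLetter]; omega))
    (fun f => cosetOp_down u q b f (by omega) (by simp only [cosetLetter]; omega))
    f ?_
  simp only [cosetPoint] at h1
  omega

theorem cosetOp_three (hb : IsHeckeFamily u q n b) {i : ℕ} (hi : i ≠ 0) (hn : i + 1 ≤ n)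
    (f : ℕ → B) :
    cosetOp u q n b i (cosetOp u q n b (i + 1) (cosetOp u q n b i f)) =
    cosetOp u q n b (i + 1) (cosetOp u q n b i (cosetOp u q n b (i + 1) f)) := by
  ext t
  by_cases h : 2 * n + 2 ≤ t
  · simp only [cosetOp_large u q b _ h]
  have ht : t < 2 * n + 2 := by omega
  by_cases h1 : i + 1 < cosetPoint n t
  · simp only [cosetOp_lt u q b _ ht h1, cosetOp_lt u q b _ ht (by omega : i < cosetPoint n t)]
    rw [mul_assoc, mul_assoc, ← mul_assoc (b i), hb.three i hi
      (by simp only [cosetPoint] at h1; omega)]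
    simp only [mul_assoc]
  by_cases h2 : cosetPoint n t + 1 < i
  · simp only [cosetOp_gt u q b _ ht h2,
      cosetOp_gt u q b _ ht (by omega : cosetPoint n t + 1 < i + 1)]
    obtain ⟨k, rfl⟩ := Nat.exists_eq_succ_of_ne_zero hi
    have := hb.three k (by omega) (by omega)
    simp only [mul_assoc, Nat.succ_eq_add_one, Nat.add_sub_cancel] at this ⊢
    rw [this]
  have hq := hb.quad i (by omega)
  have e : natParam u q (i + 1) = natParam u q i := by
    rw [natParam_of_ne u q hi, natParam_of_ne u q (by omega)]
  -- The remaining points `i - 1, i, i + 1` occur twice, on the descending and on the ascending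
  -- half. The two chains run through them in opposite orders, so `S` and `T` change roles.
  by_cases h3 : t ≤ n
  · refine braid_three_of_chain (x := n - (i + 1)) (y := n - (i + 1) + 1) (z := n - (i + 1) + 2)
      hq
      (fun f => cosetOp_lt u q b f (by omega) (by simp only [cosetPoint]; omega))
      (fun f => cosetOp_up u q b f (by omega) (by simp only [cosetLetter]; omega))
      (fun f => cosetOp_down u q b f (by omega) (by simp only [cosetLetter]; omega))
      (fun f => e ▸ cosetOp_up u q b f (by omega)
        (by simp only [cosetLetter]; omega))
      (fun f => e ▸ cosetOp_down u q b f (by omega)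
        (by simp only [cosetLetter]; omega))
      (fun f => cosetOp_gt u q b f (by omega) (by simp only [cosetPoint]; omega)) f ?_
    simp only [cosetPoint] at h1 h2
    omega
  · refine (braid_three_of_chain (x := n + i) (y := n + i + 1) (z := n + i + 2)
      hq
      (fun f => cosetOp_gt u q b f (by omega) (by simp only [cosetPoint]; omega))
      (fun f => e ▸ cosetOp_up u q b f (by omega)
        (by simp only [cosetLetter]; omega))
      (fun f => e ▸ cosetOp_down u q b f (by omega)
        (by simp only [cosetLetter]; omega))
      (fun f => cosetOp_up u q b f (by omega) (by simp only [cosetLetter]; omega))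
      (fun f => cosetOp_down u q b f (by omega) (by simp only [cosetLetter]; omega))
      (fun f => cosetOp_lt u q b f (by omega) (by simp only [cosetPoint]; omega)) f ?_).symm
    simp only [cosetPoint] at h1 h2
    omega

/-- The operators model a right action and so compose in reverse order; the opposite ring restores
the order of words. -/
theorem isHeckeFamily_op_cosetOp (hb : IsHeckeFamily u q n b) :
    IsHeckeFamily u q (n + 1) (fun j => MulOpposite.op (cosetOp u q n b j)) where
  quad i hi := by
    rw [← MulOpposite.op_mul, ← MulOpposite.op_one, ← MulOpposite.op_smul, ← MulOpposite.op_smul,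
      ← MulOpposite.op_add]
    congr 1
    ext1 f
    exact cosetOp_quad hb (by omega) f
  four hn := by
    simp only [← MulOpposite.op_mul]
    congr 1
    ext1 f
    exact (cosetOp_four hb (by omega) f).symm
  three i hi hn := by
    simp only [← MulOpposite.op_mul]
    congr 1
    ext1 f
    exact cosetOp_three hb hi (by omega) f
  comm i j hij hj := by
    simp only [← MulOpposite.op_mul]
    congr 1
    ext1 f
    exact (cosetOp_comm hb hij (by omega) f).symm

/-- The function with the value `c` at `t` and `0` elsewhere is moved to the next position. -/
theorem cosetOp_single_of_eq {t : ℕ} (hj : j ≤ n) (h : j = cosetLetter n t) (c : B) :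
    cosetOp u q n b j (Pi.single t c) = Pi.single (t + 1) c := by
  ext s
  by_cases hs : s = t + 1
  · subst hs
    rw [cosetOp_down u q b _ (by simp only [cosetLetter] at h; omega) h]
    simp
  · rw [Pi.single_eq_of_ne hs]
    rcases cosetOp_cases n hj s with h' | h' | h' | h' | ⟨r, rfl, h'⟩
    · rw [cosetOp_large u q b _ h', Pi.single_eq_of_ne, neg_zero]
      simp only [cosetLetter] at *; omega
    · rw [cosetOp_lt u q b _ h'.1 h'.2, Pi.single_eq_of_ne, zero_mul]
      simp only [cosetLetter, cosetPoint] at *; omega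
    · rw [cosetOp_gt u q b _ h'.1 h'.2, Pi.single_eq_of_ne, zero_mul]
      simp only [cosetLetter, cosetPoint] at *; omega
    · rw [cosetOp_up u q b _ (by omega) h'.2, Pi.single_eq_of_ne, smul_zero]
      simp only [cosetLetter] at *; omega
    · rw [cosetOp_down u q b _ (by omega) h'.2, Pi.single_eq_of_ne, Pi.single_eq_of_ne,
        smul_zero, add_zero]
      all_goals simp only [cosetLetter] at *; omega

theorem cosetOp_single_zero (hj : j < n) (c : B) :
    cosetOp u q n b j (Pi.single 0 c) = Pi.single 0 (c * b j) := by
  ext s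
  by_cases hs : s = 0
  · subst hs
    rw [cosetOp_lt u q b _ (by omega) (by simp only [cosetPoint]; omega)]
    simp
  · rw [Pi.single_eq_of_ne hs]
    rcases cosetOp_cases n hj.le s with h' | h' | h' | h' | ⟨r, rfl, h'⟩
    · rw [cosetOp_large u q b _ h', Pi.single_eq_of_ne hs, neg_zero]
    · rw [cosetOp_lt u q b _ h'.1 h'.2, Pi.single_eq_of_ne hs, zero_mul]
    · rw [cosetOp_gt u q b _ h'.1 h'.2, Pi.single_eq_of_ne hs, zero_mul]
    · rw [cosetOp_up u q b _ (by omega) h'.2, Pi.single_eq_of_ne (by omega), smul_zero]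
    · rw [cosetOp_down u q b _ (by omega) h'.2, Pi.single_eq_of_ne, Pi.single_eq_of_ne,
        smul_zero, add_zero]
      all_goals simp only [cosetLetter] at *; omega

theorem prod_op_cosetOp_single_zero (w : List ℕ) (hw : ∀ j ∈ w, j < n) (c : B) :
    ((w.map fun j => MulOpposite.op (cosetOp u q n b j)).prod).unop (Pi.single 0 c) =
      Pi.single 0 (c * (w.map b).prod) := by
  induction w generalizing c with
  | nil => simp
  | cons j w ih =>
    rw [List.map_cons, List.prod_cons, MulOpposite.unop_mul, Module.End.mul_apply,
      MulOpposite.unop_op, cosetOp_single_zero (hw j (by simp)),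
      ih (fun i hi => hw i (by simp [hi])), List.map_cons, List.prod_cons, mul_assoc]

theorem prod_op_cosetOp_cosetWord {t : ℕ} (ht : t ≤ 2 * n + 1) (c : B) :
    (((cosetWord n t).map fun j => MulOpposite.op (cosetOp u q n b j)).prod).unop
      (Pi.single 0 c) = Pi.single t c := by
  induction t with
  | zero => simp [cosetWord_zero]
  | succ t ih =>
    rw [cosetWord_succ, List.map_append, List.prod_append, MulOpposite.unop_mul,
      Module.End.mul_apply, ih (by omega)]
    simp only [List.map_singleton, List.prod_singleton, MulOpposite.unop_op]
    exact cosetOp_single_of_eq (by simp only [cosetLetter]; omega) rfl c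

end CosetRepresentation

/-! ### The standard basis -/

/-- The extension of a normal index by zero. -/
def NormalIndex.extend {n : ℕ} (k : NormalIndex n) (i : ℕ) : ℕ :=
  if h : i < n then (k ⟨i, h⟩).val else 0

theorem NormalIndex.extend_le {n : ℕ} (k : NormalIndex n) (i : ℕ) : k.extend i ≤ 2 * i + 1 := by
  unfold NormalIndex.extend
  split_ifs with h
  · have := (k ⟨i, h⟩).isLt
    simp only at this
    omega
  · omega

theorem NormalIndex.exists_extend {n : ℕ} {K : ℕ → ℕ} (hK : ∀ i < n, K i ≤ 2 * i + 1) :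
    ∃ k : NormalIndex n, ∀ i < n, K i = k.extend i := by
  refine ⟨fun i => ⟨K i.val, ?_⟩, fun i hi => ?_⟩
  · have := hK i.val i.isLt
    omega
  · simp [NormalIndex.extend, hi]

namespace HeckeB

variable {R : Type*} [CommRing R] {u q : R} {n : ℕ}

/-- The generators of the Hecke algebra, indexed by natural numbers. -/
noncomputable def natGen (u q : R) (n : ℕ) (i : ℕ) : HeckeB R u q n :=
  if h : i < n then a ⟨i, h⟩ else 0

theorem natGen_of_lt {i : ℕ} (h : i < n) : natGen u q n i = a ⟨i, h⟩ := dif_pos h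

theorem isHeckeFamily_natGen : IsHeckeFamily u q n (natGen u q n) where
  quad i hi := by rw [natGen_of_lt hi]; exact a_quad _
  four hn := by
    rw [natGen_of_lt hn, natGen_of_lt (by omega)]; exact a_braid_four _ _ rfl rfl
  three i hi hn := by
    rw [natGen_of_lt hn, natGen_of_lt (by omega)]; exact a_braid_three _ _ hi rfl
  comm i j hij hj := by
    rw [natGen_of_lt hj, natGen_of_lt (by omega)]; exact a_comm _ _ hij

/-- The representation defined by a family that satisfies the relations. -/
noncomputable def liftFamily {A : Type*} [Ring A] [Algebra R A] {f : ℕ → A}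
    (hf : IsHeckeFamily u q n f) : HeckeB R u q n →ₐ[R] A :=
  lift (fun i => f i.val) (by
    intro x y h
    cases h with
    | quad i =>
      simp only [map_mul, map_add, map_smul, map_one, FreeAlgebra.lift_ι_apply]
      exact hf.quad i i.isLt
    | braid_four i j hi hj =>
      simp only [map_mul, FreeAlgebra.lift_ι_apply, hi, hj]
      exact hf.four (hj ▸ j.isLt)
    | braid_three i j hi hj =>
      simp only [map_mul, FreeAlgebra.lift_ι_apply, hj]
      exact hf.three i hi (hj ▸ j.isLt)
    | comm i j hij =>
      simp only [map_mul, FreeAlgebra.lift_ι_apply]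
      exact hf.comm i j hij j.isLt)

theorem liftFamily_prod {A : Type*} [Ring A] [Algebra R A] {f : ℕ → A}
    (hf : IsHeckeFamily u q n f) (w : List ℕ) (hw : ∀ j ∈ w, j < n) :
    liftFamily hf (w.map (natGen u q n)).prod = (w.map f).prod := by
  rw [map_list_prod, List.map_map]
  congr 1
  refine List.map_congr_left fun j hj => ?_
  rw [Function.comp_apply, natGen_of_lt (hw j hj)]
  exact lift_a _ _ _

/-- Acting on the first basis vector separates the monomials by their last factor `d_t`. What is
left in position `t` is a relation between monomials of the smaller algebra. -/
theorem linearIndependent_natGen (u q : R) (n : ℕ) : LinearIndependent R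
    (fun k : NormalIndex n => ((natNormalWord n k.extend).map (natGen u q n)).prod) := by
  induction n with
  | zero =>
    rw [Fintype.linearIndependent_iff]
    intro g hg k
    -- In rank 0 all relations are void, so there is an algebra map to `R`; it sends the only
    -- monomial, `1`, to `1`.
    have hf : IsHeckeFamily u q 0 (fun _ => (0 : R)) :=
      ⟨fun i hi => by omega, fun h => by omega, fun i _ h => by omega, fun i j _ h => by omega⟩
    have := congrArg (liftFamily hf) hg
    rw [Fintype.sum_unique] at this
    simp only [natNormalWord, List.range_zero, List.flatMap_nil, List.map_nil, List.prod_nil,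
      map_smul, map_one, map_zero, smul_eq_mul, mul_one] at this
    exact (congrArg g (Subsingleton.elim k _)).trans this
  | succ n ih =>
    rw [Fintype.linearIndependent_iff] at ih ⊢
    intro g hg
    let e : Fin (2 * (n + 1)) × NormalIndex n ≃ NormalIndex (n + 1) :=
      Fin.snocEquiv (fun i : Fin (n + 1) => Fin (2 * (i.val + 1)))
    rw [← e.sum_comp, Fintype.sum_prod_type] at hg
    have hf := isHeckeFamily_op_cosetOp (isHeckeFamily_natGen (u := u) (q := q) (n := n))
    have key : ∀ (t : Fin (2 * (n + 1))) (k : NormalIndex n),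
        (liftFamily hf ((natNormalWord (n + 1) (NormalIndex.extend (e (t, k)))).map
          (natGen u q (n + 1))).prod).unop (Pi.single 0 1) =
        Pi.single t.val ((natNormalWord n k.extend).map (natGen u q n)).prod := by
      intro t k
      have e1 : NormalIndex.extend (e (t, k)) n = t.val := by
        simp only [NormalIndex.extend, Nat.lt_succ_self, dif_pos]
        exact congrArg Fin.val (Fin.snoc_last (α := fun i : Fin (n + 1) => Fin (2 * (i.val + 1)))
          t k)
      have e2 : ∀ i < n, NormalIndex.extend (e (t, k)) i = k.extend i := by
        intro i hi
        simp only [NormalIndex.extend, hi, dif_pos, Nat.lt_succ_of_lt hi]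
        exact congrArg Fin.val
          (Fin.snoc_castSucc (α := fun i : Fin (n + 1) => Fin (2 * (i.val + 1))) t k ⟨i, hi⟩)
      rw [liftFamily_prod hf _ fun j hj =>
        lt_of_mem_natNormalWord (fun i _ => NormalIndex.extend_le _ i) hj]
      rw [natNormalWord_succ, e1, natNormalWord_congr e2, List.map_append, List.prod_append,
        MulOpposite.unop_mul, Module.End.mul_apply, prod_op_cosetOp_single_zero _ fun j hj =>
        lt_of_mem_natNormalWord (fun i _ => NormalIndex.extend_le _ i) hj, one_mul,
        prod_op_cosetOp_cosetWord (by omega)]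
    -- `E t` takes `h` to coordinate `t` of the first basis vector acted on by `h`.
    let E (t : ℕ) : HeckeB R u q (n + 1) →ₗ[R] HeckeB R u q n :=
      LinearMap.proj t ∘ₗ LinearMap.applyₗ (Pi.single 0 1 : ℕ → HeckeB R u q n) ∘ₗ
        (MulOpposite.opLinearEquiv R).symm.toLinearMap ∘ₗ (liftFamily hf).toLinearMap
    have hsum : ∀ t : Fin (2 * (n + 1)), ∑ k : NormalIndex n, g (e (t, k)) •
        ((natNormalWord n k.extend).map (natGen u q n)).prod = 0 := by
      intro t
      have h0 := congrArg (E t.val) hg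
      simp only [map_sum, map_smul, map_zero] at h0
      rw [Finset.sum_eq_single t] at h0
      · rw [← h0]
        refine Finset.sum_congr rfl fun k _ => ?_
        rw [show E t.val _ = _ from congrFun (key t k) t.val, Pi.single_eq_same]
      · intro s _ hs
        refine Finset.sum_eq_zero fun k _ => ?_
        rw [show E t.val _ = _ from congrFun (key s k) t.val,
          Pi.single_eq_of_ne (fun h => hs (Fin.ext h.symm)), smul_zero]
      · simp
    intro k
    have := ih _ (hsum (e.symm k).1) (e.symm k).2
    simpa using this

end HeckeB

/-! ### The basis of monomials in the elements `b_i` -/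

theorem filter_le_range {i n : ℕ} (hi : i < n) :
    (List.range n).filter (fun j => j ≤ i) = List.range (i + 1) := by
  obtain ⟨m, rfl⟩ := Nat.exists_eq_add_of_le (Nat.succ_le_of_lt hi)
  rw [List.range_add, List.filter_append, List.filter_eq_self.2, List.filter_eq_nil_iff.2,
    List.append_nil]
  · simp only [List.mem_map, List.mem_range, decide_eq_true_eq]
    rintro _ ⟨x, _, rfl⟩
    omega
  · simp only [List.mem_range, decide_eq_true_eq]
    omega

theorem map_val_longWord {n : ℕ} (i : Fin n) :
    (longWord i).map Fin.val = cosetWord i.val (2 * i.val + 1) := by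
  have h1 : ((List.finRange n).filter (fun j => j ≤ i)).map Fin.val = List.range (i.val + 1) := by
    have e : (fun j : Fin n => decide (j ≤ i)) = (fun j => decide (j ≤ i.val)) ∘ Fin.val := by
      ext j; simp
    rw [e, ← List.filter_map, List.map_coe_finRange_eq_range, filter_le_range i.isLt]
  have h2 : ((List.finRange n).filter (fun j => 0 < j.val ∧ j ≤ i)).map Fin.val =
      (List.range i.val).map Nat.succ := by
    have e : (fun j : Fin n => decide (0 < j.val ∧ j ≤ i)) =
        fun j => ((fun j => decide (0 < j)) ∘ Fin.val) j && decide (j ≤ i) := by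
      ext j; simp
    rw [e, ← List.filter_filter, ← List.filter_map, h1, List.range_succ_eq_map,
      List.filter_cons_of_neg (by simp), List.filter_eq_self.2]
    simp
  rw [longWord, List.map_append, List.map_reverse, h1, h2]
  apply List.ext_getElem
  · simp [cosetWord]; omega
  · intro s hs hs'
    simp only [cosetWord, cosetLetter, List.getElem_append, List.getElem_map,
      List.getElem_range, List.getElem_reverse, List.length_reverse, List.length_range]
    split_ifs with h <;> omega

theorem map_val_normalWord {n : ℕ} (k : NormalIndex n) :
    (normalWord k).map Fin.val = natNormalWord n k.extend := by
  rw [normalWord, natNormalWord, List.map_flatMap, ← List.map_coe_finRange_eq_range, List.flatMap_map]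
  congr 1
  ext1 i
  have h : k.extend i.val = (k i).val := by simp [NormalIndex.extend]
  have := (k i).isLt
  rw [List.map_take, map_val_longWord, cosetWord, ← List.map_take, List.take_range, h, cosetWord,
    min_eq_left (by omega)]

theorem card_normalIndex (n : ℕ) : Fintype.card (NormalIndex n) = 2 ^ n * n.factorial := by
  rw [Fintype.card_pi]
  simp only [Fintype.card_fin]
  rw [Finset.prod_mul_distrib, Finset.prod_const, Finset.card_univ, Fintype.card_fin,
    Fin.prod_univ_eq_prod_range (fun i => i + 1) n, Finset.prod_range_add_one_eq_factorial]

namespace HeckeB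

variable {R : Type*} [CommRing R] {u q : R} {n : ℕ}

theorem prod_map_normalWord (k : NormalIndex n) :
    ((normalWord k).map (a : Fin n → HeckeB R u q n)).prod =
      ((natNormalWord n k.extend).map (natGen u q n)).prod := by
  rw [← map_val_normalWord, List.map_map]
  congr 2
  ext1 i
  rw [Function.comp_apply, natGen_of_lt i.isLt]

variable (R u q n) in
theorem exists_mem_normalSpan (h : HeckeB R u q n) :
    ∃ l, h ∈ normalSpan R (natGen u q n) n l := by
  obtain ⟨y, rfl⟩ := RingQuot.mkAlgHom_surjective R (HeckeBRel u q n) h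
  -- Only right multiplication by generators is under control, so products in the free algebra
  -- require a statement about every left factor `x`.
  suffices ∀ x : HeckeB R u q n, (∃ l, x ∈ normalSpan R (natGen u q n) n l) →
      ∃ l, x * mk y ∈ normalSpan R (natGen u q n) n l by
    obtain ⟨l, hl⟩ := this 1 ⟨0, one_mem_normalSpan _ _ _⟩
    rw [one_mul] at hl
    exact ⟨l, hl⟩
  induction y using FreeAlgebra.induction with
  | grade0 r =>
    rintro x ⟨l, hl⟩
    refine ⟨l, ?_⟩
    rw [AlgHom.commutes, ← Algebra.commutes, ← Algebra.smul_def]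
    exact Submodule.smul_mem _ _ hl
  | grade1 i =>
    rintro x ⟨l, hl⟩
    refine ⟨l + 1, ?_⟩
    have := isHeckeFamily_natGen.mul_mem_normalSpan le_rfl i.isLt hl
    rwa [natGen_of_lt i.isLt] at this
  | mul y z hy hz =>
    intro x hx
    rw [map_mul, ← mul_assoc]
    exact hz _ (hy _ hx)
  | add y z hy hz =>
    intro x hx
    obtain ⟨l, hl⟩ := hy x hx
    obtain ⟨m, hm⟩ := hz x hx
    refine ⟨max l m, ?_⟩
    rw [map_add, mul_add]
    exact add_mem (normalSpan_mono _ _ (le_max_left _ _) hl)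
      (normalSpan_mono _ _ (le_max_right _ _) hm)

theorem span_natGen : Submodule.span R (Set.range fun k : NormalIndex n =>
    ((natNormalWord n k.extend).map (natGen u q n)).prod) = ⊤ := by
  rw [eq_top_iff]
  intro h _
  obtain ⟨l, hl⟩ := exists_mem_normalSpan R u q n h
  refine Submodule.span_mono ?_ hl
  rintro x ⟨K, hK, -, rfl⟩
  obtain ⟨k, hk⟩ := NormalIndex.exists_extend hK
  exact ⟨k, by simp only [natNormalWord_congr hk]⟩

/-- The basis of monomials in normal form in the generators `a_i`. -/
noncomputable def standardBasis (u q : R) (n : ℕ) :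
    Module.Basis (NormalIndex n) R (HeckeB R u q n) :=
  Module.Basis.mk (linearIndependent_natGen u q n) span_natGen.ge

instance : Module.Free R (HeckeB R u q n) := Module.Free.of_basis (standardBasis u q n)

instance : Module.Finite R (HeckeB R u q n) := Module.Finite.of_basis (standardBasis u q n)

theorem finrank_eq [Nontrivial R] : Module.finrank R (HeckeB R u q n) = 2 ^ n * n.factorial := by
  rw [Module.finrank_eq_card_basis (standardBasis u q n), card_normalIndex]

/-- Affine changes of the generators alter the monomials by terms of smaller length. -/
theorem exists_prod_eq_smul_add {f : Fin n → HeckeB R u q n} {α β : Fin n → R}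
    (hα : ∀ i, IsUnit (α i)) (hf : ∀ i, f i = α i • a i + β i • 1) (w : List (Fin n)) :
    ∃ (c : R) (y : HeckeB R u q n), IsUnit c ∧ (w.map f).prod = c • (w.map a).prod + y ∧
      (y = 0 ∨ ∃ m < w.length, y ∈ normalSpan R (natGen u q n) n m) := by
  induction w using List.reverseRecOn with
  -- The empty word admits no `m < 0`, hence the separate alternative `y = 0`.
  | nil => exact ⟨1, 0, isUnit_one, by simp, Or.inl rfl⟩
  | append_singleton w i ih =>
    obtain ⟨c, y, hc, h, hy⟩ := ih
    have hmul : ∀ m x, x ∈ normalSpan R (natGen u q n) n m →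
        x * a i ∈ normalSpan R (natGen u q n) n (m + 1) := by
      intro m x hx
      have := isHeckeFamily_natGen.mul_mem_normalSpan le_rfl i.isLt hx
      rwa [natGen_of_lt i.isLt] at this
    have hw : (w.map a).prod ∈ normalSpan R (natGen u q n) n w.length := by
      have := (isHeckeFamily_natGen (u := u) (q := q) (n := n)).prod_mem_normalSpan
        (w.map Fin.val) (by simp)
      rw [List.map_map, List.length_map] at this
      convert this using 3
      ext1 j
      rw [Function.comp_apply, natGen_of_lt j.isLt]
    refine ⟨c * α i, (c * β i) • (w.map a).prod + (α i • (y * a i) + β i • y),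
      hc.mul (hα i), ?_, Or.inr ⟨w.length, by simp, ?_⟩⟩
    · simp only [List.map_append, List.prod_append, List.map_singleton, List.prod_singleton, h,
        hf i, add_mul, mul_add, smul_mul_assoc, mul_smul_comm, mul_one]
      module
    · refine add_mem (Submodule.smul_mem _ _ hw) ?_
      rcases hy with rfl | ⟨m, hm, hy⟩
      · simp
      · exact add_mem (Submodule.smul_mem _ _ (normalSpan_mono _ _ hm (hmul m y hy)))
          (Submodule.smul_mem _ _ (normalSpan_mono _ _ hm.le hy))

/-- Induction on length: up to the unit `c`, a monomial in the `a_i` is the corresponding monomial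
in the `f_i` minus terms that are shorter. -/
theorem span_affine {f : Fin n → HeckeB R u q n} {α β : Fin n → R}
    (hα : ∀ i, IsUnit (α i)) (hf : ∀ i, f i = α i • a i + β i • 1) :
    Submodule.span R (Set.range fun k : NormalIndex n => ((normalWord k).map f).prod) = ⊤ := by
  rw [eq_top_iff]
  intro h _
  obtain ⟨l, hl⟩ := exists_mem_normalSpan R u q n h
  suffices normalSpan R (natGen u q n) n l ≤
      Submodule.span R (Set.range fun k : NormalIndex n => ((normalWord k).map f).prod) from
    this hl
  clear hl
  induction l using Nat.strong_induction_on with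
  | _ l ih =>
  refine Submodule.span_le.2 ?_
  rintro x ⟨K, hK, hl, rfl⟩
  obtain ⟨k, hk⟩ := NormalIndex.exists_extend hK
  rw [natNormalWord_congr hk] at hl ⊢
  rw [← map_val_normalWord, List.length_map] at hl
  rw [← prod_map_normalWord, SetLike.mem_coe]
  obtain ⟨c, y, hc, h, hy⟩ := exists_prod_eq_smul_add hα hf (normalWord k)
  have hy' : y ∈ Submodule.span R
      (Set.range fun k : NormalIndex n => ((normalWord k).map f).prod) := by
    rcases hy with rfl | ⟨m, hm, hy⟩
    · exact zero_mem _
    · exact ih m (by omega) hy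
  rw [← Submodule.smul_mem_iff_of_isUnit _ hc, ← sub_eq_of_eq_add h]
  exact sub_mem (Submodule.subset_span ⟨k, rfl⟩) hy'

theorem b_eq (i : Fin n) : (b i : HeckeB R u q n) =
    (Ring.inverse (heckeParam u q i + 1) * 2) • a i +
      (-(Ring.inverse (heckeParam u q i + 1) * (heckeParam u q i - 1))) • 1 := by
  rw [b, natural_a]
  module

theorem span_normalMonomial (h2 : IsUnit (2 : R)) (hu : IsUnit (u + 1)) (hq : IsUnit (q + 1)) :
    Submodule.span R (Set.range fun k : NormalIndex n => normalMonomial u q k) = ⊤ := by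
  refine span_affine (fun i => IsUnit.mul ?_ h2) b_eq
  rw [isUnit_ringInverse, heckeParam]
  split_ifs
  exacts [hu, hq]

/-- A spanning family with as many members as the rank of a free module is independent, so no second
triangularity argument is needed. -/
theorem linearIndependent_normalMonomial [Nontrivial R] (h2 : IsUnit (2 : R))
    (hu : IsUnit (u + 1)) (hq : IsUnit (q + 1)) :
    LinearIndependent R fun k : NormalIndex n => normalMonomial u q k :=
  linearIndependent_of_top_le_span_of_card_eq_finrank (span_normalMonomial h2 hu hq).ge
    (by rw [finrank_eq, card_normalIndex])

end HeckeB

/-! ### The fixed points of `♭` -/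

namespace HeckeB

variable {R : Type*} [CommRing R] {q : R} {n : ℕ}

theorem flat_b_of_eq_zero {i : Fin n} (hi : i.val = 0) :
    flat (b i : HeckeB R 1 q n) = b i := by
  simp [b_eq, flat_a, hi]

/-- For `i ≠ 0`, `♭` agrees with `♮` on `a_i`, hence exchanges the two terms of `a_i - a_i^♮`. -/
theorem flat_b_of_ne_zero {i : Fin n} (hi : i.val ≠ 0) :
    flat (b i : HeckeB R 1 q n) = -b i := by
  simp only [b_eq, map_add, map_smul, map_one, flat_a, if_neg hi, heckeParam]
  module

theorem flat_prod_b (w : List (Fin n)) : flat ((w.map b).prod : HeckeB R 1 q n) =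
    (-1 : R) ^ (w.countP (fun j => j.val ≠ 0)) • (w.map b).prod := by
  induction w with
  | nil => simp
  | cons i w ih =>
    rw [List.map_cons, List.prod_cons, map_mul, ih]
    by_cases hi : i.val = 0
    · rw [flat_b_of_eq_zero hi, List.countP_cons_of_neg (by simpa using hi), mul_smul_comm]
    · rw [flat_b_of_ne_zero hi, List.countP_cons_of_pos (by simpa using hi), mul_smul_comm,
        pow_succ]
      simp

theorem flat_normalMonomial_of_even {k : NormalIndex n} (hk : IsFlatEven k) :
    flat (normalMonomial 1 q k : HeckeB R 1 q n) = normalMonomial 1 q k := by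
  rw [normalMonomial, flat_prod_b, Even.neg_one_pow hk, one_smul]

theorem flat_normalMonomial_of_not_even {k : NormalIndex n} (hk : ¬ IsFlatEven k) :
    flat (normalMonomial 1 q k : HeckeB R 1 q n) = -normalMonomial 1 q k := by
  rw [normalMonomial, flat_prod_b, Odd.neg_one_pow (Nat.not_even_iff_odd.1 hk), neg_one_smul]

theorem mem_flatFixed {x : HeckeB R 1 q n} : x ∈ flatFixed R q n ↔ flat x = x := Iff.rfl

theorem mem_flatAnti {x : HeckeB R 1 q n} : x ∈ flatAnti R q n ↔ flat x = -x := Iff.rfl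

theorem flat_flat (x : HeckeB R 1 q n) : flat (flat x) = x :=
  DFunLike.congr_fun flatHom_comp_flatHom x

theorem flatFixed_eq_span (h2 : IsUnit (2 : R)) (hq : IsUnit (q + 1)) :
    Subalgebra.toSubmodule (flatFixed R q n) =
      Submodule.span R {M | ∃ k : NormalIndex n, IsFlatEven k ∧ M = normalMonomial 1 q k} := by
  apply le_antisymm
  · intro x hx
    -- The symmetrization `y + y^♭` doubles even monomials and kills odd ones; at a fixed `x` it is
    -- `2x`, and 2 is invertible.
    have key : ∀ y : HeckeB R 1 q n, y + flat y ∈ Submodule.span R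
        {M | ∃ k : NormalIndex n, IsFlatEven k ∧ M = normalMonomial 1 q k} := by
      intro y
      have hy : y ∈ Submodule.span R
          (Set.range fun k : NormalIndex n => normalMonomial (1 : R) q k) := by
        rw [span_normalMonomial h2 (by rwa [one_add_one_eq_two]) hq]
        trivial
      induction hy using Submodule.span_induction with
      | mem y hy =>
        obtain ⟨k, rfl⟩ := hy
        by_cases hk : IsFlatEven k
        · rw [flat_normalMonomial_of_even hk]
          exact add_mem (Submodule.subset_span ⟨k, hk, rfl⟩) (Submodule.subset_span ⟨k, hk, rfl⟩)
        · rw [flat_normalMonomial_of_not_even hk, add_neg_cancel]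
          exact zero_mem _
      | zero => simp
      | add y z _ _ hy hz =>
        rw [map_add, add_add_add_comm]
        exact add_mem hy hz
      | smul r y _ hy =>
        rw [map_smul, ← smul_add]
        exact Submodule.smul_mem _ _ hy
    have := key x
    rw [mem_flatFixed.1 hx, ← two_smul R, Submodule.smul_mem_iff_of_isUnit _ h2] at this
    exact this
  · rw [Submodule.span_le]
    rintro _ ⟨k, hk, rfl⟩
    exact flat_normalMonomial_of_even hk

theorem isCompl_flat (h2 : IsUnit (2 : R)) :
    IsCompl (Subalgebra.toSubmodule (flatFixed R q n)) (flatAnti R q n) := by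
  constructor
  · rw [Submodule.disjoint_def]
    intro x hx hx'
    have h : x = -x := (mem_flatFixed.1 hx).symm.trans (mem_flatAnti.1 hx')
    rw [← h2.smul_eq_zero, two_smul]
    nth_rw 2 [h]
    exact add_neg_cancel x
  · rw [codisjoint_iff, eq_top_iff]
    intro x _
    rw [← Submodule.smul_mem_iff_of_isUnit _ h2,
      show (2 : R) • x = (x + flat x) + (x - flat x) by rw [two_smul]; abel]
    refine Submodule.add_mem_sup ?_ ?_
    · rw [Subalgebra.mem_toSubmodule, mem_flatFixed, map_add, flat_flat, add_comm]
    · rw [mem_flatAnti, map_sub, flat_flat, neg_sub]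

theorem free_flatFixed [Nontrivial R] (h2 : IsUnit (2 : R)) (hq : IsUnit (q + 1)) :
    Module.Free R (flatFixed R q n) := by
  have hli := (linearIndependent_normalMonomial (n := n) (u := (1 : R)) h2
    (by rwa [one_add_one_eq_two]) hq).comp (fun k : {k : NormalIndex n // IsFlatEven k} => k.1)
    Subtype.val_injective
  have e : Submodule.span R (Set.range ((fun k : NormalIndex n => normalMonomial 1 q k) ∘
      fun k : {k : NormalIndex n // IsFlatEven k} => k.1)) =
      Subalgebra.toSubmodule (flatFixed R q n) := by
    rw [flatFixed_eq_span h2 hq]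
    congr 1
    ext M
    simp [eq_comm]
  exact Module.Free.of_basis ((Module.Basis.span hli).map (LinearEquiv.ofEq _ _ e))

/-! ### The crossed product structure -/

theorem b_mul_b (hq : IsUnit (q + 1)) {i : Fin n} (hi : i.val ≠ 0) :
    (b i * b i : HeckeB R 1 q n) = 1 := by
  have hc : Ring.inverse (q + 1) * (q + 1) = 1 := Ring.inverse_mul_cancel _ hq
  simp only [b_eq, heckeParam, if_neg hi]
  generalize Ring.inverse (q + 1) = c at *
  simp only [add_mul, mul_add, smul_mul_assoc, mul_smul_comm, one_mul, mul_one,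
    a_quad_of_ne i hi]
  -- Here `b_i = c (2 a_i - (q - 1))`, so its square is `c² (4q + (q - 1)²) = c² (q + 1)²`. Writing
  -- `1` in this form leaves an identity valid for any `c`.
  have : (1 : HeckeB R 1 q n) = (c * (q + 1) * (c * (q + 1))) • 1 := by
    rw [hc, one_mul, one_smul]
  conv_rhs => rw [this]
  module

theorem mul_fixed_fixed {x y : HeckeB R 1 q n} (hx : x ∈ flatFixed R q n)
    (hy : y ∈ flatFixed R q n) : x * y ∈ flatFixed R q n := mul_mem hx hy

theorem mul_fixed_anti {x y : HeckeB R 1 q n} (hx : x ∈ flatFixed R q n)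
    (hy : y ∈ flatAnti R q n) : x * y ∈ flatAnti R q n := by
  rw [mem_flatAnti, map_mul, mem_flatFixed.1 hx, mem_flatAnti.1 hy, mul_neg]

theorem mul_anti_fixed {x y : HeckeB R 1 q n} (hx : x ∈ flatAnti R q n)
    (hy : y ∈ flatFixed R q n) : x * y ∈ flatAnti R q n := by
  rw [mem_flatAnti, map_mul, mem_flatAnti.1 hx, mem_flatFixed.1 hy, neg_mul]

theorem mul_anti_anti {x y : HeckeB R 1 q n} (hx : x ∈ flatAnti R q n)
    (hy : y ∈ flatAnti R q n) : x * y ∈ flatFixed R q n := by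
  rw [mem_flatFixed, map_mul, mem_flatAnti.1 hx, mem_flatAnti.1 hy, neg_mul_neg]

theorem b_mem_flatAnti {i : Fin n} (hi : i.val ≠ 0) : b i ∈ flatAnti R q n :=
  flat_b_of_ne_zero hi

theorem flatAnti_eq_map_mulLeft (hq : IsUnit (q + 1)) {i : Fin n} (hi : i.val ≠ 0) :
    flatAnti R q n =
      (Subalgebra.toSubmodule (flatFixed R q n)).map (LinearMap.mulLeft R (b i)) := by
  apply le_antisymm
  · intro x hx
    refine ⟨b i * x, mul_anti_anti (b_mem_flatAnti hi) hx, ?_⟩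
    rw [LinearMap.mulLeft_apply, ← mul_assoc, b_mul_b hq hi, one_mul]
  · rintro _ ⟨x, hx, rfl⟩
    exact mul_anti_fixed (b_mem_flatAnti hi) hx

theorem flatAnti_eq_map_mulRight (hq : IsUnit (q + 1)) {i : Fin n} (hi : i.val ≠ 0) :
    flatAnti R q n =
      (Subalgebra.toSubmodule (flatFixed R q n)).map (LinearMap.mulRight R (b i)) := by
  apply le_antisymm
  · intro x hx
    refine ⟨x * b i, mul_anti_anti hx (b_mem_flatAnti hi), ?_⟩
    rw [LinearMap.mulRight_apply, mul_assoc, b_mul_b hq hi, mul_one]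
  · rintro _ ⟨x, hx, rfl⟩
    exact mul_fixed_anti hx (b_mem_flatAnti hi)

/-- Multiplication by `b_2` identifies the two eigenspaces of `♭`, so each has half of the rank `2 ^
n * n!`. -/
theorem finrank_flatFixed [Nontrivial R] (h2 : IsUnit (2 : R)) (hq : IsUnit (q + 1))
    (hn : 2 ≤ n) : Module.finrank R (flatFixed R q n) = 2 ^ (n - 1) * n.factorial := by
  have hi : (⟨1, hn⟩ : Fin n).val ≠ 0 := one_ne_zero
  have hinj : Function.Injective (LinearMap.mulLeft R (b ⟨1, hn⟩ : HeckeB R 1 q n)) := by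
    intro x y h
    have := congrArg (b ⟨1, hn⟩ * ·) h
    simpa only [LinearMap.mulLeft_apply, ← mul_assoc, b_mul_b hq hi, one_mul] using this
  let e : flatFixed R q n ≃ₗ[R] flatAnti R q n :=
    (Submodule.equivMapOfInjective _ hinj (Subalgebra.toSubmodule (flatFixed R q n))).trans
      (LinearEquiv.ofEq _ _ (flatAnti_eq_map_mulLeft hq hi).symm)
  have hfree : Module.Free R (flatFixed R q n) := free_flatFixed h2 hq
  let p : (flatFixed R q n × flatAnti R q n) ≃ₗ[R] HeckeB R 1 q n :=
    Submodule.prodEquivOfIsCompl _ _ (isCompl_flat h2)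
  have hfin : Module.Finite R (flatFixed R q n) :=
    Module.Finite.of_surjective (LinearMap.fst R (flatFixed R q n) (flatAnti R q n) ∘ₗ p.symm.toLinearMap)
      ((LinearMap.fst_surjective (R := R)).comp p.symm.surjective)
  have h := ((LinearEquiv.refl R (flatFixed R q n)).prodCongr e ≪≫ₗ p).finrank_eq
  rw [Module.finrank_prod, finrank_eq] at h
  obtain ⟨m, rfl⟩ := Nat.exists_eq_add_of_le' (by omega : 1 ≤ n)
  rw [pow_succ] at h
  rw [Nat.add_sub_cancel]
  linarith

theorem isGradedCliffordSystem (h2 : IsUnit (2 : R)) (hq : IsUnit (q + 1)) {i : Fin n}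
    (hi : i.val ≠ 0) : IsGradedCliffordSystem (S := Multiplicative (ZMod 2))
      (fun s => if s = 1 then Subalgebra.toSubmodule (flatFixed R q n) else flatAnti R q n)
      (fun s => if s = 1 then 1 else b i) := by
  have hcases : ∀ s : Multiplicative (ZMod 2), s = 1 ∨ s = Multiplicative.ofAdd 1 := by decide
  have hne : (Multiplicative.ofAdd 1 : Multiplicative (ZMod 2)) ≠ 1 := by decide
  have hsq : (Multiplicative.ofAdd 1 * Multiplicative.ofAdd 1 : Multiplicative (ZMod 2)) = 1 := by
    decide
  have hb := b_mul_b (R := R) hq hi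
  have hone : (1 : HeckeB R 1 q n) ∈ Subalgebra.toSubmodule (flatFixed R q n) :=
    one_mem (flatFixed R q n)
  refine ⟨inferInstance, ?_, ?_, ?_, ?_, ?_, ?_, ?_⟩
  · intro s t
    rcases hcases s with rfl | rfl <;> rcases hcases t with rfl | rfl <;>
      simp only [hne, hsq, one_mul, mul_one, if_true, if_false]
    · apply le_antisymm
      · exact Submodule.mul_le.2 fun x hx y hy => mul_fixed_fixed hx hy
      · intro x hx
        simpa using Submodule.mul_mem_mul hone hx
    · apply le_antisymm
      · exact Submodule.mul_le.2 fun x hx y hy => mul_fixed_anti hx hy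
      · intro x hx
        simpa using Submodule.mul_mem_mul hone hx
    · apply le_antisymm
      · exact Submodule.mul_le.2 fun x hx y hy => mul_anti_fixed hx hy
      · intro x hx
        simpa using Submodule.mul_mem_mul hx hone
    · apply le_antisymm
      · exact Submodule.mul_le.2 fun x hx y hy => mul_anti_anti hx hy
      · intro x hx
        -- Since `b i` is an involution, `x = b i * (b i * x)` is a product of two elements negated
        -- by `♭`.
        have := Submodule.mul_mem_mul (b_mem_flatAnti hi)
          (mul_anti_fixed (b_mem_flatAnti (q := q) hi) hx)
        rwa [← mul_assoc, hb, one_mul] at this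
  · intro s
    rcases hcases s with rfl | rfl
    · simp
    · simpa only [hne, if_false] using Units.isUnit ⟨b i, b i, hb, hb⟩
  · intro s
    rcases hcases s with rfl | rfl
    · simpa only [if_true] using hone
    · simpa only [hne, if_false] using b_mem_flatAnti hi
  · intro s
    rcases hcases s with rfl | rfl
    · simp
    · simpa only [hne, if_false, if_true] using flatAnti_eq_map_mulLeft hq hi
  · intro s
    rcases hcases s with rfl | rfl
    · simp
    · simpa only [hne, if_false, if_true] using flatAnti_eq_map_mulRight hq hi
  · rw [DirectSum.isInternal_submodule_iff_isCompl _ hne.symm]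
    · simpa only [hne, if_false, if_true] using isCompl_flat h2
    · ext s
      simpa using hcases s
  · simpa only [if_true] using hone

end HeckeB

instance R3.instNontrivial : Nontrivial R3 := by
  have h : (2 * X * (X + 1) : ℤ[X]) ≠ 0 :=
    mul_ne_zero (mul_ne_zero two_ne_zero X_ne_zero) (X_add_C_ne_zero 1)
  have := IsLocalization.isDomain_localization
    (powers_le_nonZeroDivisors_of_noZeroDivisors h)
  exact this.toNontrivial

theorem proposition4p5 (n : ℕ) (hn : 1 ≤ n) :
    -- the fixed subalgebra is the direct sum of the lines spanned by the even monomials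
    Subalgebra.toSubmodule (HeckeB.flatFixed R3 R3.q n) =
        Submodule.span R3 {M | ∃ k : NormalIndex n, IsFlatEven k ∧ M = normalMonomial 1 R3.q k} ∧
      LinearIndependent R3
        (fun k : {k : NormalIndex n // IsFlatEven k} => normalMonomial 1 R3.q k.1) ∧
      -- its rank, for `n ≥ 2`
      (2 ≤ n → Module.Free R3 (HeckeB.flatFixed R3 R3.q n) ∧
        Module.finrank R3 (HeckeB.flatFixed R3 R3.q n) = 2 ^ (n - 1) * n.factorial) ∧
      -- it is the even part of a crossed product with the units `1` and `b_2`, for `n ≥ 2`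
      (∀ h2 : 2 ≤ n, IsGradedCliffordSystem (S := Multiplicative (ZMod 2))
        (fun s => if s = 1 then Subalgebra.toSubmodule (HeckeB.flatFixed R3 R3.q n)
          else HeckeB.flatAnti R3 R3.q n)
        (fun s => if s = 1 then 1 else HeckeB.b ⟨1, h2⟩)) := by
  refine ⟨HeckeB.flatFixed_eq_span R3.isUnit_two R3.isUnit_q_add_one, ?_, fun h2 =>
    ⟨HeckeB.free_flatFixed R3.isUnit_two R3.isUnit_q_add_one,
      HeckeB.finrank_flatFixed R3.isUnit_two R3.isUnit_q_add_one h2⟩, fun h2 =>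
    HeckeB.isGradedCliffordSystem R3.isUnit_two R3.isUnit_q_add_one one_ne_zero⟩
  exact (HeckeB.linearIndependent_normalMonomial (n := n) (u := (1 : R3)) R3.isUnit_two
    (by rw [one_add_one_eq_two]; exact R3.isUnit_two) R3.isUnit_q_add_one).comp
    (fun k : {k : NormalIndex n // IsFlatEven k} => k.1) Subtype.val_injective
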